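/- Let $T>0$ and let $(\Omega,\mathcal F,(\mathcal F_t)_{0\le t\le T},\mathbb P)$ be a filtered probability space carrying a one-dimensional Wiener process $W$ relative to $(\mathcal F_t)$ and an $\mathcal F_0$-measurable random variable $\xi$ whose law $\lambda_0$ satisfies $\int_{\mathbb R} e^{p|x|}\,\lambda_0(dx)<\infty$ for all $p>0$. Let $\sigma>0$, let $A\subset\mathbb R$ be a compact interval containing $0$, let $X_0,k_0>0$, $0<\phi\le 1$, and let $M$ satisfy $|a|\le M$ for all $a\in A$ and $M<X_0/T$. Let $h:[0,T]\times\mathbb R\to\mathbb R$ and $l:\mathbb R\to\mathbb R$ be measurable with $|h(t,x)|+|l(x)|\le c_1e^{c_1|x|}$ for all $(t,x)\in[0,T]\times\mathbb R$, where $c_1>0$. Put $\psi(x)=e^{c_1|x|}$, let $\mathcal P_\psi(\mathbb R)$ be the set of probability measures $\mu$ on $\mathbb R$ with $\int\psi\,d\mu<\infty$, with the weakest topology making $\mu\mapsto\int f\,d\mu$ continuous for every measurable $f$ with $\sup|f|/\psi<\infty$, and let $b(t,x,\mu,a)=a$, $g(x,\mu)=l(x)$. For a measurable flow $q=(q_t)_{0\le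 t\le T}$ of probability measures on $A$ write $$m_t=\int_A\tilde a\,dq_t(\tilde a),\qquad I_t=\int_0^t m_s\,ds,\qquad \kappa=\frac{1+\phi^2}{2\phi}-1,$$ $$\Gamma=k_0\,m_t\,\frac{(1+\phi)X_0-2\phi I_t}{(X_0-I_t)^2(X_0-\phi I_t)^2},\qquad \Lambda_1=-\frac12\left[(a\kappa)^2+\left(\frac{k_0}{(X_0-I_t)^2(X_0-\phi I_t)^2}\right)^2\right],\qquad \Lambda_2=-a\,\kappa\,\frac{k_0}{(X_0+TM)^4},$$ and, for $(t,x)\in[0,T]\times\mathbb R$, $\mu\in\mathcal P_\psi(\mathbb R)$, $q$ a flow as above and $a\in A$, $$f_1(t,x,\mu,q,a)=x\Gamma+\Lambda_1-h(t,x),\qquad f_2(t,x,\mu,q,a)=x\Gamma+\Lambda_2-h(t,x).$$ Then, for each $f\in\{f_1,f_2\}$, the mean field game problem with data $(A,b,\sigma,f,g,\psi,\xi,W)$ satisfies all of the following. * (S.1) $A$ is compact and convex, and $b:[0,T]\times\mathbb R\times\mathcal P_\psi(\mathbb R)\times A\to\mathbb R$ is continuous. * (S.2) The driftless equation $dX_t=\sigma\,dW_t$,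 $X_0=\xi$, has a strong solution $X$ with continuous paths and $\mathbb E[\psi^2(X)]<\infty$, where $\psi(X)=\sup_{0\le t\le T}\psi(X_t)$; moreover $\sigma>0$ and $\sigma^{-1}b$ is uniformly bounded. * (S.3) For each $(\mu,q,a)$ the map $(t,x)\mapsto f(t,x_t,\mu,q,a)$ is progressively measurable on $[0,T]\times C([0,T];\mathbb R)$ for the canonical filtration; for each $(t,x,\mu,q)$ the map $a\mapsto f(t,x,\mu,q,a)$ is continuous on $A$; and $x\mapsto g(x,\mu)$ is Borel measurable for each $\mu$. * (S.4) There is $c>0$ such that $|g(x,\mu)|+|f(t,x,\mu,q,a)|\le c\,\psi(x)=c\,e^{c_1|x|}$ for all $(t,x,\mu,q,a)$. * (S.5) There are functions $F_1,F_2$ with $f(t,x,\mu,q,a)=F_1(t,x,\mu,a)+F_2(t,x,\mu,q)$ for all $(t,x,\mu,q,a)$. -/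

import Mathlib

open MeasureTheory ProbabilityTheory Set Filter

namespace PoolMFG

/-! ### Spaces -/

/-- The path space `C([0,T]; ℝ)`, a Banach space for the supremum norm. -/
abbrev Path (T : ℝ) : Type := C(Icc (0 : ℝ) T, ℝ)

/-- The path space carries its Borel σ-algebra. -/
instance instMeasurableSpacePath (T : ℝ) : MeasurableSpace (Path T) := borel (Path T)

/-- The canonical filtration on path space: at time `t` it is generated by the
coordinates `x ↦ x s` with `s ≤ t`. -/
def canonicalFiltration (T : ℝ) :
    Filtration (Icc (0 : ℝ) T) (instMeasurableSpacePath T) where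
  seq t := ⨆ s ≤ t, MeasurableSpace.comap (fun x : Path T => x s) inferInstance
  mono' _ _ hst := biSup_mono fun _ h => h.trans hst
  le' t := by
    refine iSup₂_le fun s _ => ?_
    rw [← measurable_iff_comap_le]
    exact Continuous.borel_measurable (continuous_eval_const s)

/-- `𝒫_ψ(ℝ)`: the probability measures on `ℝ` that integrate `ψ`. -/
def WeightedProb (ψ : ℝ → ℝ) : Type :=
  {μ : ProbabilityMeasure ℝ // Integrable ψ (μ : Measure ℝ)}

/-- `B_ψ(ℝ)`: the measurable functions `f` with `sup |f| / ψ < ∞`. -/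
def WeightBounded (ψ f : ℝ → ℝ) : Prop :=
  Measurable f ∧ ∃ C : ℝ, ∀ x, |f x| ≤ C * ψ x

/-- The topology `τ_ψ(ℝ)` on `𝒫_ψ(ℝ)`: the weakest one making `μ ↦ ∫ f dμ`
continuous for every `f ∈ B_ψ(ℝ)`. -/
noncomputable instance instTopologicalSpaceWeightedProb (ψ : ℝ → ℝ) :
    TopologicalSpace (WeightedProb ψ) :=
  ⨅ f : {f : ℝ → ℝ // WeightBounded ψ f},
    TopologicalSpace.induced
      (fun μ : WeightedProb ψ => ∫ x, f.1 x ∂(μ.1 : Measure ℝ)) inferInstance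

/-- A measurable flow `q = (q_t)_{0 ≤ t ≤ T}` of probability measures on the control
space `A`. -/
def ControlFlow (T : ℝ) (A : Set ℝ) : Type :=
  {q : Kernel (Icc (0 : ℝ) T) A // IsMarkovKernel q}

/-! ### Driving noise and the driftless state equation -/

/-- `W` is a Wiener process on `[0,T]` relative to the filtration `F`. -/
structure IsWiener {Ω : Type*} {mΩ : MeasurableSpace Ω} {T : ℝ}
    (F : Filtration (Icc (0 : ℝ) T) mΩ) (W : Icc (0 : ℝ) T → Ω → ℝ)
    (P : Measure Ω) : Prop where
  adapted : ∀ t, Measurable[F t] (W t)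
  start : ∀ t : Icc (0 : ℝ) T, (t : ℝ) = 0 → ∀ᵐ ω ∂P, W t ω = 0
  law : ∀ s t : Icc (0 : ℝ) T, s ≤ t →
    HasLaw (fun ω => W t ω - W s ω) (gaussianReal 0 ((t : ℝ) - (s : ℝ)).toNNReal) P
  indep : ∀ s t : Icc (0 : ℝ) T, s ≤ t →
    Indep (MeasurableSpace.comap (fun ω => W t ω - W s ω) inferInstance) (F s) P
  cont : ∀ᵐ ω ∂P, Continuous fun t => W t ω

/-- The σ-algebra generated by `ξ` and `(W_s)_{s ≤ t}`, augmented by the `P`-null sets. -/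
abbrev noiseSigma {Ω : Type*} [MeasurableSpace Ω] {T : ℝ} (P : Measure Ω) (ξ : Ω → ℝ)
    (W : Icc (0 : ℝ) T → Ω → ℝ) (t : Icc (0 : ℝ) T) : MeasurableSpace Ω :=
  eventuallyMeasurableSpace
    (MeasurableSpace.comap ξ inferInstance ⊔ ⨆ s ≤ t, MeasurableSpace.comap (W s) inferInstance)
    (ae P)

/-- `X`, a random continuous path, is a strong solution of `dX_t = σ dW_t`, `X_0 = ξ`, with
constant `σ`: it is adapted to the augmented filtration of `(ξ, W)`, starts at `ξ`, and its
increments are the stochastic integrals `∫_s^t σ dW = σ (W_t - W_s)`. -/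
structure IsStrongSolution {Ω : Type*} [MeasurableSpace Ω] {T : ℝ} (P : Measure Ω)
    (ξ : Ω → ℝ) (W : Icc (0 : ℝ) T → Ω → ℝ) (σ : ℝ) (X : Ω → Path T) : Prop where
  adapted : ∀ t, Measurable[noiseSigma P ξ W t] fun ω => X ω t
  init : ∀ᵐ ω ∂P, ∀ t : Icc (0 : ℝ) T, (t : ℝ) = 0 → X ω t = ξ ω
  incr : ∀ᵐ ω ∂P, ∀ s t : Icc (0 : ℝ) T, s ≤ t → X ω t - X ω s = σ * (W t ω - W s ω)

/-! ### Mean field game data and the structural conditions -/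

/-- The data of a mean field game with state in `ℝ`, control space `A`, horizon `T`, weight
function `ψ`: drift `b(t,x,μ,a)`, constant volatility `σ`, running reward `f(t,x,μ,q,a)` and
terminal reward `g(x,μ)`. The running reward at time `t` may depend on the whole flow `q`. -/
structure Game (T : ℝ) (A : Set ℝ) (ψ : ℝ → ℝ) where
  b : Icc (0 : ℝ) T → ℝ → WeightedProb ψ → A → ℝ
  σ : ℝ
  f : Icc (0 : ℝ) T → ℝ → WeightedProb ψ → ControlFlow T A → A → ℝ
  g : ℝ → WeightedProb ψ → ℝ

namespace Game

variable {T : ℝ} {A : Set ℝ} {ψ : ℝ → ℝ}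

/-- (S.1) The control space is compact and convex, and the drift is (jointly) continuous. -/
def S1 (G : Game T A ψ) : Prop :=
  IsCompact A ∧ Convex ℝ A ∧
    Continuous fun p : Icc (0 : ℝ) T × ℝ × WeightedProb ψ × A =>
      G.b p.1 p.2.1 p.2.2.1 p.2.2.2

/-- (S.2) The driftless state equation has a strong solution `X` with `E[ψ²(X)] < ∞`, where
`ψ(X)` is the supremum of `ψ(X_t)` over `[0,T]`; the volatility is positive and `σ⁻¹ b` is
uniformly bounded. -/
def S2 (G : Game T A ψ) {Ω : Type*} [MeasurableSpace Ω] (P : Measure Ω) (ξ : Ω → ℝ)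
    (W : Icc (0 : ℝ) T → Ω → ℝ) : Prop :=
  (∃ X : Ω → Path T, IsStrongSolution P ξ W G.σ X ∧
      ∫⁻ ω, (⨆ t : Icc (0 : ℝ) T, ENNReal.ofReal (ψ (X ω t))) ^ 2 ∂P < ⊤) ∧
    0 < G.σ ∧
    ∃ K : ℝ, ∀ t x μ a, |G.σ⁻¹ * G.b t x μ a| ≤ K

/-- (S.3) For fixed `(μ,q,a)` the running reward is progressively measurable along the
canonical path process, it is continuous in `a`, and the terminal reward is Borel in `x`. -/
def S3 (G : Game T A ψ) : Prop :=
  (∀ μ q a, IsProgressive (canonicalFiltration T) fun t (x : Path T) => G.f t (x t) μ q a) ∧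
    (∀ t x μ q, Continuous fun a : A => G.f t x μ q a) ∧
    ∀ μ, Measurable fun x => G.g x μ

/-- (S.4) The rewards grow at most like the weight `ψ`. -/
def S4 (G : Game T A ψ) : Prop :=
  ∃ c : ℝ, 0 < c ∧ ∀ t x μ q a, |G.g x μ| + |G.f t x μ q a| ≤ c * ψ x

/-- (S.5) The running reward separates the control `a` from the control distribution `q`. -/
def S5 (G : Game T A ψ) : Prop :=
  ∃ (F₁ : Icc (0 : ℝ) T → ℝ → WeightedProb ψ → A → ℝ)
    (F₂ : Icc (0 : ℝ) T → ℝ → WeightedProb ψ → ControlFlow T A → ℝ),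
    ∀ t x μ q a, G.f t x μ q a = F₁ t x μ a + F₂ t x μ q

end Game

/-! ### The liquidity pool model -/

section Pool

variable {T : ℝ} {A : Set ℝ}

/-- The average control `∫_A ã dq_t(ã)` at time `t`. -/
noncomputable def meanControl (q : ControlFlow T A) (t : Icc (0 : ℝ) T) : ℝ :=
  ∫ a : A, (a : ℝ) ∂(q.1 t)

/-- The accumulated average control `∫_0^t ∫_A ã dq_s(ã) ds` (Lebesgue measure on `[0,t]`). -/
noncomputable def accControl (q : ControlFlow T A) (t : Icc (0 : ℝ) T) : ℝ :=
  ∫ s in Iic t, meanControl q s ∂(Measure.comap Subtype.val (volume : Measure ℝ))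

/-- The price sensitivity `Γ`. -/
noncomputable def Gam (X₀ k₀ φ : ℝ) (t : Icc (0 : ℝ) T) (q : ControlFlow T A) : ℝ :=
  k₀ * meanControl q t *
    (((1 + φ) * X₀ - 2 * φ * accControl q t) /
      ((X₀ - accControl q t) ^ 2 * (X₀ - φ * accControl q t) ^ 2))

/-- The lower auxiliary cost term `Λ₁`. -/
noncomputable def Lam₁ (X₀ k₀ φ : ℝ) (t : Icc (0 : ℝ) T) (q : ControlFlow T A) (a : A) : ℝ :=
  -(1 / 2) * (((a : ℝ) * ((1 + φ ^ 2) / (2 * φ) - 1)) ^ 2 +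
    (k₀ / ((X₀ - accControl q t) ^ 2 * (X₀ - φ * accControl q t) ^ 2)) ^ 2)

/-- The upper auxiliary cost term `Λ₂`, where `M` bounds the controls over the horizon `T`. -/
noncomputable def Lam₂ (T X₀ k₀ φ M : ℝ) (a : A) : ℝ :=
  -(a : ℝ) * ((1 + φ ^ 2) / (2 * φ) - 1) * (k₀ / (X₀ + T * M) ^ 4)

/-- The weight `ψ(x) = exp(c₁ |x|)`. -/
noncomputable def expWeight (c₁ : ℝ) (x : ℝ) : ℝ := Real.exp (c₁ * |x|)

/-- The auxiliary reward `f₁ = x Γ + Λ₁ - h`. -/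
noncomputable def reward₁ (X₀ k₀ φ : ℝ) (h : Icc (0 : ℝ) T → ℝ → ℝ) (ψ : ℝ → ℝ)
    (t : Icc (0 : ℝ) T) (x : ℝ) (_μ : WeightedProb ψ) (q : ControlFlow T A) (a : A) : ℝ :=
  x * Gam X₀ k₀ φ t q + Lam₁ X₀ k₀ φ t q a - h t x

/-- The auxiliary reward `f₂ = x Γ + Λ₂ - h`. -/
noncomputable def reward₂ (X₀ k₀ φ M : ℝ) (h : Icc (0 : ℝ) T → ℝ → ℝ) (ψ : ℝ → ℝ)
    (t : Icc (0 : ℝ) T) (x : ℝ) (_μ : WeightedProb ψ) (q : ControlFlow T A) (a : A) : ℝ :=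
  x * Gam X₀ k₀ φ t q + Lam₂ T X₀ k₀ φ M a - h t x

/-- The game induced by a running reward `f`: drift `b(t,x,μ,a) = a`, constant volatility `σ`
and terminal reward `g(x,μ) = l(x)`. -/
def inducedGame {ψ : ℝ → ℝ} (σ : ℝ) (l : ℝ → ℝ)
    (f : Icc (0 : ℝ) T → ℝ → WeightedProb ψ → ControlFlow T A → A → ℝ) : Game T A ψ where
  b _ _ _ a := a
  σ := σ
  f := f
  g x _ := l x

end Pool

end PoolMFG

/-! Two facts carry the theorem. The analytic one: `|m_t| ≤ M` gives `|I_t| ≤ T M < X₀`, so both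
factors of the denominators are at least `X₀ - T M > 0`. Hence `Γ`, `Λ₁` and `Λ₂` are bounded, and
the reward is affine in `x` with bounded coefficients, minus `h`; an exponential weight dominates it
(`abs_Gam_le`, `inducedGame_S4`).

The probabilistic one is the moment in (S.2) for `X = ξ + σ W`. Splitting a product of exponentials
by `u v ≤ u² + v²` separates `ξ` from `W`, so the running maximum of `exp (p |W|)` must be
integrable. The process `exp (2pW) + exp (-2pW)` is a submartingale dominating `exp (p |W|) ^ 2`.
The weak maximal inequality on a finite grid gives the square root of its maximum a tail of order
`t⁻²`, which is integrable. The bound involves only time `T`, so Fatou's lemma and path continuity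
carry it to the full supremum. -/

namespace PoolMFG

open scoped ENNReal NNReal Topology

/-! ### Integrability from the weak maximal inequality -/

/-- A nonnegative random variable with quadratically decaying tails is integrable. -/
theorem lintegral_ofReal_le_of_tail {Ω : Type*} [MeasurableSpace Ω] {P : Measure Ω}
    [IsProbabilityMeasure P] {Z : Ω → ℝ} (hZ : AEMeasurable Z P) (hZ0 : 0 ≤ Z) {C : ℝ}
    (hC : 0 ≤ C) (htail : ∀ t : ℝ, 0 < t → P {ω | t ≤ Z ω} ≤ ENNReal.ofReal (C * t ^ (-2 : ℝ))) :
    ∫⁻ ω, ENNReal.ofReal (Z ω) ∂P ≤ 1 + ENNReal.ofReal C := by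
  -- Layer-cake formula, cut at `1`: probabilities are at most `1` below, the tail bound is
  -- integrable above.
  rw [lintegral_eq_lintegral_meas_le P (ae_of_all _ hZ0) hZ,
    ← Ioc_union_Ioi_eq_Ioi (zero_le_one (α := ℝ))]
  refine (lintegral_union_le _ _ _).trans (add_le_add ?_ ?_)
  · calc ∫⁻ t in Ioc (0 : ℝ) 1, P {ω | t ≤ Z ω} ≤ ∫⁻ _ in Ioc (0 : ℝ) 1, 1 :=
          lintegral_mono fun _ => prob_le_one
      _ = 1 := by simp
  · have hint : IntegrableOn (fun t : ℝ => C * t ^ (-2 : ℝ)) (Ioi 1) :=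
      (integrableOn_Ioi_rpow_of_lt (by norm_num) one_pos).const_mul C
    calc ∫⁻ t in Ioi (1 : ℝ), P {ω | t ≤ Z ω}
        ≤ ∫⁻ t in Ioi (1 : ℝ), ENNReal.ofReal (C * t ^ (-2 : ℝ)) :=
          setLIntegral_mono' measurableSet_Ioi fun t ht => htail t (one_pos.trans ht)
      _ = ENNReal.ofReal (∫ t in Ioi (1 : ℝ), C * t ^ (-2 : ℝ)) := by
          rw [ofReal_integral_eq_lintegral_ofReal hint]
          filter_upwards [ae_restrict_mem measurableSet_Ioi] with t ht
          have : (0 : ℝ) < t := one_pos.trans ht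
          positivity
      _ = ENNReal.ofReal C := by
          rw [integral_const_mul, integral_Ioi_rpow_of_lt (by norm_num) one_pos]
          norm_num

/-- The square root of the running maximum of a nonnegative submartingale is integrable, with a
bound that depends on the terminal expectation only. -/
theorem lintegral_sqrt_sup_le_of_submartingale {Ω : Type*} {mΩ : MeasurableSpace Ω}
    {P : Measure Ω} [IsProbabilityMeasure P] {𝒢 : Filtration ℕ mΩ} {f : ℕ → Ω → ℝ}
    (hf : Submartingale f 𝒢 P) (hf0 : 0 ≤ f) (n : ℕ) :
    ∫⁻ ω, ENNReal.ofReal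
        (√((Finset.range (n + 1)).sup' Finset.nonempty_range_add_one fun k => f k ω)) ∂P
      ≤ 1 + ENNReal.ofReal (∫ ω, f n ω ∂P) := by
  have hmeas : Measurable fun ω =>
      (Finset.range (n + 1)).sup' Finset.nonempty_range_add_one fun k => f k ω :=
    Finset.measurable_range_sup'' fun k _ => (hf.stronglyMeasurable k).measurable.mono (𝒢.le k) le_rfl
  refine lintegral_ofReal_le_of_tail hmeas.sqrt.aemeasurable (fun ω => Real.sqrt_nonneg _)
    (integral_nonneg (hf0 n)) fun t ht => ?_
  -- The square root turns level `t` into level `t ^ 2` for the maximum, hence a tail `C / t ^ 2`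
  -- instead of the non-integrable `C / t`.
  have hset : {ω | t ≤ √((Finset.range (n + 1)).sup' Finset.nonempty_range_add_one
        fun k => f k ω)} = {ω | (((t ^ 2).toNNReal : ℝ≥0) : ℝ) ≤ (Finset.range (n + 1)).sup'
        Finset.nonempty_range_add_one fun k => f k ω} := by
    ext ω
    rw [mem_ofPred_eq, mem_ofPred_eq, Real.coe_toNNReal _ (sq_nonneg t), Real.le_sqrt' ht]
  have hmax := maximal_ineq hf hf0 (ε := (t ^ 2).toNNReal) n
  rw [← hset] at hmax
  have hle : ENNReal.ofReal (∫ ω in {ω | t ≤ √((Finset.range (n + 1)).sup'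
      Finset.nonempty_range_add_one fun k => f k ω)}, f n ω ∂P) ≤
      ENNReal.ofReal (∫ ω, f n ω ∂P) :=
    ENNReal.ofReal_le_ofReal
      (setIntegral_le_integral (hf.integrable n) (ae_of_all _ (hf0 n)))
  have ht2 : (0 : ℝ) < t ^ 2 := by positivity
  rw [Real.rpow_neg ht.le, ← div_eq_mul_inv, Real.rpow_two, ENNReal.ofReal_div_of_pos ht2,
    ENNReal.le_div_iff_mul_le (Or.inl (by simpa using ht.ne')) (Or.inl ENNReal.ofReal_ne_top),
    mul_comm]
  exact hmax.trans hle

/-! ### Exponentials of a Wiener process -/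

namespace IsWiener

variable {Ω : Type*} {mΩ : MeasurableSpace Ω} {P : Measure Ω} {T : ℝ}
  {F : Filtration (Icc (0 : ℝ) T) mΩ} {W : Icc (0 : ℝ) T → Ω → ℝ}

theorem measurable (hW : IsWiener F W P) (t : Icc (0 : ℝ) T) : Measurable (W t) :=
  (hW.adapted t).mono (F.le t) le_rfl

theorem integrable_exp_mul_increment (hW : IsWiener F W P) {s t : Icc (0 : ℝ) T} (hst : s ≤ t)
    (p : ℝ) : Integrable (fun ω => Real.exp (p * (W t ω - W s ω))) P := by
  have h := integrable_exp_mul_gaussianReal (μ := 0) (v := ((t : ℝ) - (s : ℝ)).toNNReal) p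
  rw [← (hW.law s t hst).map_eq] at h
  exact h.comp_aemeasurable (hW.law s t hst).aemeasurable

/-- The Gaussian moment generating function is `exp (v p² / 2)`. This makes the exponential a
submartingale for either sign of `p`. -/
theorem one_le_integral_exp_mul_increment (hW : IsWiener F W P) {s t : Icc (0 : ℝ) T}
    (hst : s ≤ t) (p : ℝ) : 1 ≤ ∫ ω, Real.exp (p * (W t ω - W s ω)) ∂P := by
  have h := mgf_gaussianReal (hW.law s t hst).map_eq p
  rw [mgf] at h
  rw [h, zero_mul, zero_add]
  exact Real.one_le_exp (by positivity)

theorem integrable_exp_mul (hW : IsWiener F W P) (hT : 0 ≤ T) (t : Icc (0 : ℝ) T) (p : ℝ) :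
    Integrable (fun ω => Real.exp (p * W t ω)) P := by
  have h0 : (⟨0, le_rfl, hT⟩ : Icc (0 : ℝ) T) ≤ t := t.2.1
  refine (hW.integrable_exp_mul_increment h0 p).congr ?_
  filter_upwards [hW.start ⟨0, le_rfl, hT⟩ rfl] with ω hω
  rw [hω, sub_zero]

variable [IsProbabilityMeasure P]

/-- Factor out the `F s`-measurable `exp (p W_s)`; the remaining factor is independent of `F s`, so
its conditional expectation is its mean. -/
theorem exp_mul_le_condExp (hW : IsWiener F W P) (hT : 0 ≤ T) {s t : Icc (0 : ℝ) T}
    (hst : s ≤ t) (p : ℝ) :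
    (fun ω => Real.exp (p * W s ω)) ≤ᵐ[P] P[fun ω => Real.exp (p * W t ω) | F s] := by
  have hprod : (fun ω => Real.exp (p * W t ω)) =
      (fun ω => Real.exp (p * W s ω)) * fun ω => Real.exp (p * (W t ω - W s ω)) := by
    ext ω
    rw [Pi.mul_apply, ← Real.exp_add]
    ring_nf
  have hpull := condExp_mul_of_stronglyMeasurable_left (μ := P) (m := F s)
    (f := fun ω => Real.exp (p * W s ω)) (g := fun ω => Real.exp (p * (W t ω - W s ω)))
    ((hW.adapted s).const_mul p).exp.stronglyMeasurable
    (hprod ▸ hW.integrable_exp_mul hT t p) (hW.integrable_exp_mul_increment hst p)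
  have hincr : Measurable fun ω => W t ω - W s ω := (hW.measurable t).sub (hW.measurable s)
  have hind := condExp_indep_eq (μ := P) (f := fun ω => Real.exp (p * (W t ω - W s ω)))
    hincr.comap_le (F.le s)
    (((comap_measurable fun ω => W t ω - W s ω).const_mul p).exp.stronglyMeasurable)
    (hW.indep s t hst)
  rw [hprod]
  filter_upwards [hpull, hind] with ω h1 h2
  rw [h1, Pi.mul_apply, h2]
  exact le_mul_of_one_le_right (Real.exp_pos _).le (hW.one_le_integral_exp_mul_increment hst p)

/-- Exponentials of a Wiener process sampled along a monotone sequence of times form a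
submartingale. -/
theorem submartingale_exp_mul (hW : IsWiener F W P) (hT : 0 ≤ T) {τ : ℕ → Icc (0 : ℝ) T}
    (hτ : Monotone τ) (p : ℝ) :
    Submartingale (fun k ω => Real.exp (p * W (τ k) ω))
      ⟨fun k => F (τ k), fun _ _ hij => F.mono (hτ hij), fun k => F.le (τ k)⟩ P :=
  submartingale_nat
    (fun k => ((hW.adapted (τ k)).const_mul p).exp.stronglyMeasurable)
    (fun k => hW.integrable_exp_mul hT (τ k) p)
    (fun k => hW.exp_mul_le_condExp hT (hτ k.le_succ) p)

end IsWiener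

/-! ### Running maximum by discretization -/

/-- The uniform grid `k T / n` of `[0,T]`. -/
noncomputable def gridTime {T : ℝ} (hT : 0 ≤ T) (n k : ℕ) : Icc (0 : ℝ) T :=
  projIcc 0 T hT (T * (k / n))

theorem gridTime_mono {T : ℝ} (hT : 0 ≤ T) (n : ℕ) : Monotone (gridTime hT n) := by
  intro i j hij
  refine monotone_projIcc hT ?_
  gcongr

theorem gridTime_self {T : ℝ} (hT : 0 ≤ T) (n : ℕ) :
    gridTime hT (n + 1) (n + 1) = ⟨T, hT, le_rfl⟩ := by
  rw [gridTime, div_self (by positivity), mul_one]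
  exact projIcc_right hT

theorem exists_tendsto_gridTime {T : ℝ} (hT : 0 < T) (t : Icc (0 : ℝ) T) :
    ∃ k : ℕ → ℕ, (∀ n, k n ≤ n + 1) ∧
      Tendsto (fun n => gridTime hT.le (n + 1) (k n)) atTop (𝓝 t) := by
  have ht0 : 0 ≤ (t : ℝ) / T := div_nonneg t.2.1 hT.le
  have ht1 : (t : ℝ) / T ≤ 1 := (div_le_one hT).2 t.2.2
  -- Rounding `t` down to the grid with `n + 1` cells; `n + 1` also avoids division by zero.
  refine ⟨fun n => ⌊(t : ℝ) / T * ((n + 1 : ℕ) : ℝ)⌋₊, fun n => ?_, ?_⟩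
  · refine Nat.floor_le_of_le ?_
    exact mul_le_of_le_one_left (by positivity) ht1
  · have h1 : Tendsto (fun n : ℕ => ((n + 1 : ℕ) : ℝ)) atTop atTop :=
      tendsto_natCast_atTop_atTop.comp (tendsto_add_atTop_nat 1)
    have h2 := ((tendsto_nat_floor_mul_div_atTop ht0).comp h1).const_mul T
    have h3 := ((continuous_projIcc (h := hT.le)).tendsto (T * ((t : ℝ) / T))).comp h2
    rw [mul_div_cancel₀ _ hT.ne', projIcc_val] at h3
    exact h3

/-- Exponential moments of the running maximum of a Wiener process are finite. -/
theorem IsWiener.lintegral_iSup_exp_abs_lt_top {Ω : Type*} {mΩ : MeasurableSpace Ω}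
    {P : Measure Ω} [IsProbabilityMeasure P] {T : ℝ} (hT : 0 < T)
    {F : Filtration (Icc (0 : ℝ) T) mΩ} {W : Icc (0 : ℝ) T → Ω → ℝ} (hW : IsWiener F W P)
    (p : ℝ) :
    ∫⁻ ω, ⨆ t, ENNReal.ofReal (Real.exp (p * |W t ω|)) ∂P < ⊤ := by
  set τ := gridTime hT.le
  -- The exponent is `2 * p` because the square root in `S` halves it.
  let f : ℕ → ℕ → Ω → ℝ := fun n k ω =>
    Real.exp (2 * p * W (τ n k) ω) + Real.exp (-(2 * p) * W (τ n k) ω)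
  let S : ℕ → Ω → ℝ≥0∞ := fun n ω => ENNReal.ofReal
    (√((Finset.range (n + 1 + 1)).sup' Finset.nonempty_range_add_one fun k => f (n + 1) k ω))
  have hf0 : ∀ n, 0 ≤ f n := fun n k ω => by positivity
  have hfm : ∀ n k, Measurable (f n k) := fun n k =>
    ((hW.measurable _).const_mul _).exp.add ((hW.measurable _).const_mul _).exp
  have hSm : ∀ n, Measurable (S n) := fun n =>
    (Finset.measurable_range_sup'' fun k _ => hfm (n + 1) k).sqrt.ennreal_ofReal
  have hS : ∀ n, ∫⁻ ω, S n ω ∂P ≤ 1 + ENNReal.ofReal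
      (∫ ω, (Real.exp (2 * p * W ⟨T, hT.le, le_rfl⟩ ω) +
        Real.exp (-(2 * p) * W ⟨T, hT.le, le_rfl⟩ ω)) ∂P) := by
    intro n
    have h := lintegral_sqrt_sup_le_of_submartingale
      ((hW.submartingale_exp_mul hT.le (gridTime_mono hT.le (n + 1)) (2 * p)).add
        (hW.submartingale_exp_mul hT.le (gridTime_mono hT.le (n + 1)) (-(2 * p))))
      (hf0 (n + 1)) (n + 1)
    simpa only [Pi.add_apply, gridTime_self] using h
  -- The grids are not nested, so no monotone limit is available. For each `t`, one grid point per
  -- `n` converging to `t` bounds the value by the `liminf`.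
  have hle : ∀ᵐ ω ∂P, ⨆ t, ENNReal.ofReal (Real.exp (p * |W t ω|)) ≤
      liminf (fun n => S n ω) atTop := by
    filter_upwards [hW.cont] with ω hω
    refine iSup_le fun t => ?_
    obtain ⟨k, hk, hlim⟩ := exists_tendsto_gridTime hT t
    have hcont : Continuous fun s => ENNReal.ofReal (Real.exp (p * |W s ω|)) :=
      ENNReal.continuous_ofReal.comp (Real.continuous_exp.comp (hω.abs.const_mul p))
    rw [← ((hcont.tendsto t).comp hlim).liminf_eq]
    refine liminf_le_liminf (Eventually.of_forall fun n => ENNReal.ofReal_le_ofReal ?_)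
    refine Real.le_sqrt_of_sq_le (le_trans ?_ (Finset.le_sup' (fun k => f (n + 1) k ω)
      (Finset.mem_range.2 (Nat.lt_succ_of_le (hk n)))))
    simp only [f, τ]
    rw [← Real.exp_nat_mul]
    rcases abs_cases (W (gridTime hT.le (n + 1) (k n)) ω) with ⟨h, -⟩ | ⟨h, -⟩
    · rw [h]
      refine le_trans (le_of_eq ?_) (le_add_of_nonneg_right (Real.exp_pos _).le)
      push_cast; ring_nf
    · rw [h]
      refine le_trans (le_of_eq ?_) (le_add_of_nonneg_left (Real.exp_pos _).le)
      push_cast; ring_nf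
  calc ∫⁻ ω, ⨆ t, ENNReal.ofReal (Real.exp (p * |W t ω|)) ∂P
      ≤ ∫⁻ ω, liminf (fun n => S n ω) atTop ∂P := lintegral_mono_ae hle
    _ ≤ liminf (fun n => ∫⁻ ω, S n ω ∂P) atTop := lintegral_liminf_le hSm
    _ ≤ _ := (liminf_le_liminf (Eventually.of_forall hS)).trans_eq (liminf_const _)
    _ < ⊤ := ENNReal.add_lt_top.2 ⟨ENNReal.one_lt_top, ENNReal.ofReal_lt_top⟩

/-! ### The driftless equation -/

section StrongSolution

variable {Ω : Type*} {mΩ : MeasurableSpace Ω} {P : Measure Ω} {T : ℝ}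
  {F : Filtration (Icc (0 : ℝ) T) mΩ} {W : Icc (0 : ℝ) T → Ω → ℝ} {ξ : Ω → ℝ} {σ : ℝ}

open Classical in
/-- The path `ξ + σ W`, set to zero where `W` is discontinuous. -/
noncomputable def driftlessPath (ξ : Ω → ℝ) (W : Icc (0 : ℝ) T → Ω → ℝ) (σ : ℝ) (ω : Ω) :
    Path T :=
  if hc : Continuous fun t => W t ω then ⟨fun t => ξ ω + σ * W t ω, by fun_prop⟩ else 0

theorem IsWiener.driftlessPath_apply (hW : IsWiener F W P) :
    ∀ᵐ ω ∂P, ∀ t, driftlessPath ξ W σ ω t = ξ ω + σ * W t ω := by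
  filter_upwards [hW.cont] with ω hω t
  rw [driftlessPath, dif_pos hω]
  rfl

theorem IsWiener.isStrongSolution_driftlessPath (hW : IsWiener F W P) :
    IsStrongSolution P ξ W σ (driftlessPath ξ W σ) where
  adapted t := by
    have hξ : Measurable[MeasurableSpace.comap ξ inferInstance ⊔
        ⨆ s ≤ t, MeasurableSpace.comap (W s) inferInstance] ξ :=
      (comap_measurable ξ).mono le_sup_left le_rfl
    have hWt : Measurable[MeasurableSpace.comap ξ inferInstance ⊔
        ⨆ s ≤ t, MeasurableSpace.comap (W s) inferInstance] (W t) :=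
      (comap_measurable (W t)).mono
        ((le_iSup₂ (f := fun s (_ : s ≤ t) => MeasurableSpace.comap (W s) inferInstance) t
          le_rfl).trans le_sup_right) le_rfl
    -- The path differs from `ξ + σ W` only on a null set, which the augmentation absorbs.
    refine Measurable.eventuallyMeasurable_of_eventuallyEq (hξ.add (hWt.const_mul σ)) ?_
    filter_upwards [hW.driftlessPath_apply] with ω hω
    exact hω t
  init := by
    -- The sign of `T` is not known here; for `T < 0` there are no times.
    rcases isEmpty_or_nonempty (Icc (0 : ℝ) T) with hT | ⟨⟨u, hu⟩⟩
    · exact ae_of_all _ fun ω t => isEmptyElim t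
    · filter_upwards [hW.driftlessPath_apply (ξ := ξ) (σ := σ),
        hW.start ⟨0, le_rfl, hu.1.trans hu.2⟩ rfl] with ω hω h0 t ht
      have : t = ⟨0, le_rfl, hu.1.trans hu.2⟩ := Subtype.ext ht
      rw [hω, this, h0, mul_zero, add_zero]
  incr := by
    filter_upwards [hW.driftlessPath_apply (ξ := ξ) (σ := σ)] with ω hω s t _
    rw [hω, hω]
    ring

/-- The driftless state has exponential moments of its running maximum. -/
theorem IsWiener.lintegral_iSup_expWeight_sq_lt_top [IsProbabilityMeasure P] (hT : 0 < T)
    (hW : IsWiener F W P) {c : ℝ} (hc : 0 ≤ c) (hσ : 0 ≤ σ)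
    (hξ : Integrable (fun ω => Real.exp (4 * c * |ξ ω|)) P) :
    ∫⁻ ω, (⨆ t, ENNReal.ofReal (expWeight c (driftlessPath ξ W σ ω t))) ^ 2 ∂P < ⊤ := by
  have hle : ∀ᵐ ω ∂P, (⨆ t, ENNReal.ofReal (expWeight c (driftlessPath ξ W σ ω t))) ^ 2 ≤
      ENNReal.ofReal (Real.exp (4 * c * |ξ ω|)) +
        ⨆ t, ENNReal.ofReal (Real.exp (4 * c * σ * |W t ω|)) := by
    filter_upwards [hW.driftlessPath_apply (ξ := ξ) (σ := σ)] with ω hω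
    rw [ENNReal.iSup_pow_of_ne_zero two_ne_zero]
    refine iSup_le fun t => le_trans ?_ (add_le_add_right
      (le_iSup (fun t => ENNReal.ofReal (Real.exp (4 * c * σ * |W t ω|))) t) _)
    rw [hω, expWeight, ← ENNReal.ofReal_pow (Real.exp_pos _).le,
      ← ENNReal.ofReal_add (Real.exp_pos _).le (Real.exp_pos _).le]
    refine ENNReal.ofReal_le_ofReal ?_
    have habs : |ξ ω + σ * W t ω| ≤ |ξ ω| + σ * |W t ω| :=
      (abs_add_le _ _).trans_eq (by rw [abs_mul, abs_of_nonneg hσ])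
    have hx : Real.exp (4 * c * |ξ ω|) = Real.exp (2 * c * |ξ ω|) ^ 2 := by
      rw [← Real.exp_nat_mul]; push_cast; ring_nf
    have hy : Real.exp (4 * c * σ * |W t ω|) = Real.exp (2 * c * σ * |W t ω|) ^ 2 := by
      rw [← Real.exp_nat_mul]; push_cast; ring_nf
    calc Real.exp (c * |ξ ω + σ * W t ω|) ^ 2
        ≤ Real.exp (c * (|ξ ω| + σ * |W t ω|)) ^ 2 := by gcongr
      _ = Real.exp (2 * c * |ξ ω|) * Real.exp (2 * c * σ * |W t ω|) := by
          rw [← Real.exp_nat_mul, ← Real.exp_add]; push_cast; ring_nf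
      _ ≤ Real.exp (4 * c * |ξ ω|) + Real.exp (4 * c * σ * |W t ω|) := by
          rw [hx, hy]
          -- This is `u v ≤ u² + v²`; squaring doubles the exponent, whence `4 * c`.
          nlinarith [sq_nonneg (Real.exp (2 * c * |ξ ω|) - Real.exp (2 * c * σ * |W t ω|)),
            sq_nonneg (Real.exp (2 * c * |ξ ω|)), sq_nonneg (Real.exp (2 * c * σ * |W t ω|))]
  refine (lintegral_mono_ae hle).trans_lt ?_
  rw [lintegral_add_left' hξ.aemeasurable.ennreal_ofReal]
  refine ENNReal.add_lt_top.2 ⟨?_, hW.lintegral_iSup_exp_abs_lt_top hT _⟩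
  rw [← ofReal_integral_eq_lintegral_ofReal hξ (ae_of_all _ fun _ => (Real.exp_pos _).le)]
  exact ENNReal.ofReal_lt_top

end StrongSolution

/-! ### Measurability and bounds for the price sensitivity -/

section Rewards

variable {T : ℝ} {A : Set ℝ}

/-- A Carathéodory argument: evaluation is continuous in time and, at each time up to `i`,
measurable in the path. -/
theorem isProgressive_eval (T : ℝ) :
    IsProgressive (canonicalFiltration T) fun t (x : Path T) => x t := fun i =>
  measurable_uncurry_of_continuous_of_measurable (m := canonicalFiltration T i)
    (u := fun (s : Iic i) (x : Path T) => x s)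
    (fun x => x.continuous.comp continuous_subtype_val) fun s =>
      (comap_measurable fun x : Path T => x s).mono
        (le_iSup₂ (f := fun r (_ : r ≤ i) =>
          MeasurableSpace.comap (fun x : Path T => x r) inferInstance) s.1 s.2) le_rfl

theorem comap_volume_Icc_univ (T : ℝ) :
    Measure.comap (Subtype.val : Icc (0 : ℝ) T → ℝ) volume univ = ENNReal.ofReal T := by
  rw [comap_subtype_coe_apply measurableSet_Icc, image_univ, Subtype.range_coe, Real.volume_Icc,
    sub_zero]

theorem isFiniteMeasure_comap_volume_Icc (T : ℝ) :
    IsFiniteMeasure (Measure.comap (Subtype.val : Icc (0 : ℝ) T → ℝ) volume) :=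
  ⟨(comap_volume_Icc_univ T).trans_lt ENNReal.ofReal_lt_top⟩

theorem measurable_meanControl (q : ControlFlow T A) : Measurable (meanControl q) :=
  (measurable_subtype_coe.stronglyMeasurable.integral_kernel (κ := q.1)).measurable

theorem measurable_accControl (q : ControlFlow T A) : Measurable (accControl q) := by
  -- The moving domain `Iic t` becomes an indicator on the product, so that measurability of
  -- parametric integrals applies.
  have hset : MeasurableSet {p : Icc (0 : ℝ) T × Icc (0 : ℝ) T | p.2 ≤ p.1} :=
    measurableSet_le measurable_snd measurable_fst
  have hind : StronglyMeasurable ({p : Icc (0 : ℝ) T × Icc (0 : ℝ) T | p.2 ≤ p.1}.indicator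
      fun p => meanControl q p.2) :=
    (((measurable_meanControl q).comp measurable_snd).indicator hset).stronglyMeasurable
  have := isFiniteMeasure_comap_volume_Icc T
  have hmeas := hind.integral_prod_right'
    (ν := Measure.comap (Subtype.val : Icc (0 : ℝ) T → ℝ) volume)
  convert hmeas.measurable using 2 with t
  rw [accControl, ← integral_indicator measurableSet_Iic]
  rfl

theorem abs_meanControl_le {M : ℝ} (hM : ∀ a ∈ A, |a| ≤ M) (q : ControlFlow T A)
    (t : Icc (0 : ℝ) T) : |meanControl q t| ≤ M := by
  have := q.2
  have h := norm_integral_le_of_norm_le_const (μ := q.1 t) (f := fun a : A => (a : ℝ)) (C := M)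
    (ae_of_all _ fun a => hM a a.2)
  rwa [probReal_univ, mul_one] at h

theorem abs_accControl_le {M : ℝ} (hM0 : 0 ≤ M) (hM : ∀ a ∈ A, |a| ≤ M) (q : ControlFlow T A)
    (t : Icc (0 : ℝ) T) : |accControl q t| ≤ T * M := by
  have hT : 0 ≤ T := t.2.1.trans t.2.2
  have hle : Measure.comap (Subtype.val : Icc (0 : ℝ) T → ℝ) volume (Iic t) ≤ ENNReal.ofReal T :=
    (measure_mono (subset_univ _)).trans_eq (comap_volume_Icc_univ T)
  have h := norm_setIntegral_le_of_norm_le_const (hle.trans_lt ENNReal.ofReal_lt_top)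
    (f := meanControl q) (C := M) fun s _ => abs_meanControl_le hM q s
  rw [mul_comm]
  exact h.trans (mul_le_mul_of_nonneg_left (ENNReal.toReal_le_of_le_ofReal hT hle) hM0)

variable {X₀ k₀ φ M : ℝ}

/-- Used with `r = 1` and `r = φ`, the two factors of the denominators. -/
theorem le_sub_mul_accControl (hM0 : 0 ≤ M) (hM : ∀ a ∈ A, |a| ≤ M) (q : ControlFlow T A)
    (t : Icc (0 : ℝ) T) {r : ℝ} (hr0 : 0 ≤ r) (hr1 : r ≤ 1) :
    X₀ - T * M ≤ X₀ - r * accControl q t := by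
  have h := abs_accControl_le hM0 hM q t
  have h1 : r * accControl q t ≤ |accControl q t| :=
    (mul_le_mul_of_nonneg_left (le_abs_self _) hr0).trans
      (mul_le_of_le_one_left (abs_nonneg _) hr1)
  linarith

theorem pow_four_le_denominator (hM0 : 0 ≤ M) (hM : ∀ a ∈ A, |a| ≤ M) (hX : 0 ≤ X₀ - T * M)
    (hφ0 : 0 ≤ φ) (hφ1 : φ ≤ 1) (q : ControlFlow T A) (t : Icc (0 : ℝ) T) :
    (X₀ - T * M) ^ 4 ≤ (X₀ - accControl q t) ^ 2 * (X₀ - φ * accControl q t) ^ 2 := by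
  have h1 := le_sub_mul_accControl (X₀ := X₀) hM0 hM q t zero_le_one le_rfl
  rw [one_mul] at h1
  have h2 := le_sub_mul_accControl (X₀ := X₀) hM0 hM q t hφ0 hφ1
  calc (X₀ - T * M) ^ 4 = (X₀ - T * M) ^ 2 * (X₀ - T * M) ^ 2 := by ring
    _ ≤ _ := by gcongr

theorem abs_Gam_le (hX₀ : 0 ≤ X₀) (hk₀ : 0 ≤ k₀) (hM0 : 0 ≤ M) (hM : ∀ a ∈ A, |a| ≤ M)
    (hX : 0 < X₀ - T * M) (hφ0 : 0 ≤ φ) (hφ1 : φ ≤ 1) (t : Icc (0 : ℝ) T) (q : ControlFlow T A) :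
    |Gam X₀ k₀ φ t q| ≤ k₀ * M * ((2 * X₀ + 2 * (T * M)) / (X₀ - T * M) ^ 4) := by
  have hden := pow_four_le_denominator hM0 hM hX.le hφ0 hφ1 q t
  have hI := abs_accControl_le hM0 hM q t
  have hnum : |(1 + φ) * X₀ - 2 * φ * accControl q t| ≤ 2 * X₀ + 2 * (T * M) := by
    refine (abs_sub _ _).trans ?_
    rw [abs_mul, abs_mul, abs_of_nonneg hX₀, abs_of_nonneg (by positivity : 0 ≤ 1 + φ),
      abs_of_nonneg (by positivity : 0 ≤ 2 * φ)]
    gcongr <;> linarith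
  rw [Gam, abs_mul, abs_mul, abs_div, abs_of_nonneg hk₀,
    abs_of_nonneg (by positivity : 0 ≤ (X₀ - accControl q t) ^ 2 * (X₀ - φ * accControl q t) ^ 2)]
  have hd : 0 < (X₀ - T * M) ^ 4 := by positivity
  have hn : 0 ≤ 2 * X₀ + 2 * (T * M) := (abs_nonneg _).trans hnum
  have := abs_meanControl_le hM q t
  gcongr

theorem measurable_Gam (q : ControlFlow T A) : Measurable fun t => Gam X₀ k₀ φ t q := by
  have h1 := measurable_meanControl q
  have h2 := measurable_accControl q
  unfold Gam
  fun_prop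

end Rewards

/-! ### Games with reward `x γ(t,q) + α(a) + β(t,q) - h(t,x)` -/

section Induced

variable {T c₁ σ : ℝ} {A : Set ℝ} {h : Icc (0 : ℝ) T → ℝ → ℝ} {l : ℝ → ℝ}
  {f : Icc (0 : ℝ) T → ℝ → WeightedProb (expWeight c₁) → ControlFlow T A → A → ℝ}
  {γ β : Icc (0 : ℝ) T → ControlFlow T A → ℝ} {α : A → ℝ}

theorem inducedGame_S1 {ψ : ℝ → ℝ}
    {f : Icc (0 : ℝ) T → ℝ → WeightedProb ψ → ControlFlow T A → A → ℝ}
    (hA : IsCompact A) (hA' : Convex ℝ A) : (inducedGame σ l f).S1 :=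
  ⟨hA, hA', by unfold inducedGame; fun_prop⟩

theorem inducedGame_S2 {Ω : Type*} {mΩ : MeasurableSpace Ω} {P : Measure Ω}
    [IsProbabilityMeasure P] {F : Filtration (Icc (0 : ℝ) T) mΩ} {W : Icc (0 : ℝ) T → Ω → ℝ}
    {ξ : Ω → ℝ} {M : ℝ} (hT : 0 < T) (hW : IsWiener F W P) (hc₁ : 0 ≤ c₁) (hσ : 0 < σ)
    (hξ : Integrable (fun ω => Real.exp (4 * c₁ * |ξ ω|)) P) (hM : ∀ a ∈ A, |a| ≤ M) :
    (inducedGame σ l f).S2 P ξ W := by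
  refine ⟨⟨driftlessPath ξ W σ, hW.isStrongSolution_driftlessPath,
    hW.lintegral_iSup_expWeight_sq_lt_top hT hc₁ hσ.le hξ⟩, hσ, σ⁻¹ * M, fun t x μ a => ?_⟩
  change |σ⁻¹ * (a : ℝ)| ≤ _
  rw [abs_mul, abs_of_pos (inv_pos.2 hσ)]
  exact mul_le_mul_of_nonneg_left (hM a a.2) (inv_pos.2 hσ).le

theorem inducedGame_S3
    (hf : ∀ t x μ q a, f t x μ q a = x * γ t q + (α a + β t q) - h t x)
    (hγ : ∀ q, Measurable fun t => γ t q) (hβ : ∀ q, Measurable fun t => β t q)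
    (hα : Continuous α) (hh : Measurable fun p : Icc (0 : ℝ) T × ℝ => h p.1 p.2)
    (hl : Measurable l) : (inducedGame σ l f).S3 := by
  refine ⟨fun μ q a i => ?_, fun t x μ q => ?_, fun _ => hl⟩
  · have hjoint : Measurable fun p : Icc (0 : ℝ) T × ℝ => f p.1 p.2 μ q a := by
      simp only [hf]
      exact ((measurable_snd.mul ((hγ q).comp measurable_fst)).add
        (((hβ q).comp measurable_fst).const_add _)).sub hh
    exact hjoint.comp ((measurable_subtype_coe.comp measurable_fst).prodMk (isProgressive_eval T i))
  · simp only [inducedGame, hf]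
    fun_prop

theorem inducedGame_S4
    (hf : ∀ t x μ q a, f t x μ q a = x * γ t q + (α a + β t q) - h t x) (hc₁ : 0 < c₁)
    {G a₀ b₀ : ℝ} (hG : 0 ≤ G) (ha₀ : 0 ≤ a₀) (hb₀ : 0 ≤ b₀)
    (hγ : ∀ t q, |γ t q| ≤ G) (hα : ∀ a, |α a| ≤ a₀) (hβ : ∀ t q, |β t q| ≤ b₀)
    (hgrowth : ∀ t x, |h t x| + |l x| ≤ c₁ * Real.exp (c₁ * |x|)) :
    (inducedGame σ l f).S4 := by
  -- `c₁` pays for `h` and `l`, `G / c₁` for the linear term through `c₁ |x| ≤ exp (c₁ |x|)`, and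
  -- `a₀ + b₀` for the bounded terms since the weight is at least `1`.
  refine ⟨c₁ + G / c₁ + (a₀ + b₀), by positivity, fun t x μ q a => ?_⟩
  change |l x| + |f t x μ q a| ≤ _ * Real.exp (c₁ * |x|)
  have hexp := Real.add_one_le_exp (c₁ * |x|)
  have hc : 0 ≤ c₁ * |x| := by positivity
  have h1 : |x * γ t q| ≤ G / c₁ * Real.exp (c₁ * |x|) := by
    calc |x * γ t q| = |x| * |γ t q| := abs_mul _ _
      _ ≤ |x| * G := by gcongr; exact hγ t q
      _ = G / c₁ * (c₁ * |x|) := by field_simp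
      _ ≤ _ := by gcongr; linarith
  have h2 : |α a + β t q| ≤ (a₀ + b₀) * Real.exp (c₁ * |x|) :=
    calc |α a + β t q| ≤ a₀ + b₀ := (abs_add_le _ _).trans (add_le_add (hα a) (hβ t q))
      _ ≤ _ := le_mul_of_one_le_right (by positivity) (by linarith)
  have h3 : |f t x μ q a| ≤ |x * γ t q| + |α a + β t q| + |h t x| := by
    rw [hf]
    exact (abs_sub _ _).trans (add_le_add_left (abs_add_le _ _) _)
  linarith [hgrowth t x]

theorem inducedGame_S5
    (hf : ∀ t x μ q a, f t x μ q a = x * γ t q + (α a + β t q) - h t x) :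
    (inducedGame σ l f).S5 := by
  refine ⟨fun _ _ _ a => α a, fun t x _ q => x * γ t q + β t q - h t x, fun t x μ q a => ?_⟩
  change f t x μ q a = _
  rw [hf]
  ring

end Induced

/-! ### The two pool rewards -/

section Pool

variable {T X₀ k₀ φ M c₁ : ℝ} {A : Set ℝ}

theorem abs_control_mul_le (hM : ∀ a ∈ A, |a| ≤ M) (κ : ℝ) (a : A) :
    |(a : ℝ) * κ| ≤ M * |κ| := by
  rw [abs_mul]
  exact mul_le_mul_of_nonneg_right (hM a a.2) (abs_nonneg κ)

theorem reward₁_conditions {σ : ℝ} {h : Icc (0 : ℝ) T → ℝ → ℝ} {l : ℝ → ℝ}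
    (hX₀ : 0 ≤ X₀) (hk₀ : 0 ≤ k₀) (hM0 : 0 ≤ M) (hM : ∀ a ∈ A, |a| ≤ M)
    (hX : 0 < X₀ - T * M) (hT : 0 ≤ T) (hφ0 : 0 ≤ φ) (hφ1 : φ ≤ 1)
    (hh : Measurable fun p : Icc (0 : ℝ) T × ℝ => h p.1 p.2) (hl : Measurable l) (hc₁ : 0 < c₁)
    (hgrowth : ∀ t x, |h t x| + |l x| ≤ c₁ * Real.exp (c₁ * |x|)) :
    let G : Game T A (expWeight c₁) :=
      inducedGame σ l (reward₁ X₀ k₀ φ h (expWeight c₁))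
    G.S3 ∧ G.S4 ∧ G.S5 := by
  -- `Λ₁` is already a sum of a square in `a` and a square in `(t, q)`.
  have hf : ∀ t x μ q a, reward₁ (A := A) X₀ k₀ φ h (expWeight c₁) t x μ q a =
      x * Gam X₀ k₀ φ t q + (-(1 / 2) * ((a : ℝ) * ((1 + φ ^ 2) / (2 * φ) - 1)) ^ 2 +
        -(1 / 2) * (k₀ / ((X₀ - accControl q t) ^ 2 * (X₀ - φ * accControl q t) ^ 2)) ^ 2) -
        h t x := by
    intro t x μ q a
    rw [reward₁, Lam₁]
    ring
  refine ⟨inducedGame_S3 hf measurable_Gam (fun q => ?_) (by fun_prop) hh hl,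
    inducedGame_S4 hf hc₁ (by positivity)
      (a₀ := 1 / 2 * (M * |(1 + φ ^ 2) / (2 * φ) - 1|) ^ 2)
      (b₀ := 1 / 2 * (k₀ / (X₀ - T * M) ^ 4) ^ 2) (by positivity) (by positivity)
      (abs_Gam_le hX₀ hk₀ hM0 hM hX hφ0 hφ1) (fun a => ?_) (fun t q => ?_) hgrowth,
    inducedGame_S5 hf⟩
  · have := measurable_accControl q
    fun_prop
  · rw [abs_mul, abs_neg, abs_of_nonneg (one_half_pos (α := ℝ)).le, abs_pow]
    gcongr
    exact abs_control_mul_le hM _ a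
  · have hden := pow_four_le_denominator hM0 hM hX.le hφ0 hφ1 q t
    rw [abs_mul, abs_neg, abs_of_nonneg (one_half_pos (α := ℝ)).le, abs_pow,
      abs_of_nonneg (a := k₀ / _) (by positivity)]
    have hd : 0 < (X₀ - T * M) ^ 4 := by positivity
    gcongr

theorem reward₂_conditions {σ : ℝ} {h : Icc (0 : ℝ) T → ℝ → ℝ} {l : ℝ → ℝ}
    (hX₀ : 0 ≤ X₀) (hk₀ : 0 ≤ k₀) (hM0 : 0 ≤ M) (hM : ∀ a ∈ A, |a| ≤ M)
    (hX : 0 < X₀ - T * M) (hT : 0 ≤ T) (hφ0 : 0 ≤ φ) (hφ1 : φ ≤ 1)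
    (hh : Measurable fun p : Icc (0 : ℝ) T × ℝ => h p.1 p.2) (hl : Measurable l) (hc₁ : 0 < c₁)
    (hgrowth : ∀ t x, |h t x| + |l x| ≤ c₁ * Real.exp (c₁ * |x|)) :
    let G : Game T A (expWeight c₁) :=
      inducedGame σ l (reward₂ X₀ k₀ φ M h (expWeight c₁))
    G.S3 ∧ G.S4 ∧ G.S5 := by
  -- The denominator of `Λ₂` is the constant `(X₀ + T * M) ^ 4`, so there is no `q`-part and `β =
  -- 0`.
  have hf : ∀ t x μ q a, reward₂ (A := A) X₀ k₀ φ M h (expWeight c₁) t x μ q a =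
      x * Gam X₀ k₀ φ t q + (Lam₂ T X₀ k₀ φ M a + (fun _ _ => 0) t q) - h t x := by
    intro t x μ q a
    rw [reward₂, add_zero]
  refine ⟨inducedGame_S3 hf measurable_Gam (fun q => measurable_const)
      (by unfold Lam₂; fun_prop) hh hl,
    inducedGame_S4 hf hc₁ (by positivity)
      (a₀ := M * |(1 + φ ^ 2) / (2 * φ) - 1| * (k₀ / (X₀ + T * M) ^ 4)) (b₀ := 0)
      (by positivity) le_rfl
      (abs_Gam_le hX₀ hk₀ hM0 hM hX hφ0 hφ1) (fun a => ?_) (fun t q => abs_zero.le) hgrowth,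
    inducedGame_S5 hf⟩
  rw [Lam₂, abs_mul, neg_mul, abs_neg, abs_of_nonneg (a := k₀ / _) (by positivity)]
  gcongr
  exact abs_control_mul_le hM _ a

end Pool

end PoolMFG

theorem mainTheorem4
    {Ω : Type*} [mΩ : MeasurableSpace Ω] (P : Measure Ω) [IsProbabilityMeasure P]
    (T : ℝ) (hT : 0 < T)
    (F : Filtration (Icc (0 : ℝ) T) mΩ)
    (W : Icc (0 : ℝ) T → Ω → ℝ) (hW : PoolMFG.IsWiener F W P)
    (lam₀ : Measure ℝ) [IsProbabilityMeasure lam₀]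
    (hlam₀ : ∀ p : ℝ, 0 < p → Integrable (fun x => Real.exp (p * |x|)) lam₀)
    (ξ : Ω → ℝ) (hξ_meas : Measurable[F ⟨0, le_rfl, hT.le⟩] ξ) (hξ_law : HasLaw ξ lam₀ P)
    (σ : ℝ) (hσ : 0 < σ)
    (lo hi : ℝ) (hlo : lo ≤ 0) (hhi : 0 ≤ hi)
    (X₀ k₀ φ M : ℝ) (hX₀ : 0 < X₀) (hk₀ : 0 < k₀) (hφ_pos : 0 < φ) (hφ_le : φ ≤ 1)
    (hM : ∀ a ∈ Icc lo hi, |a| ≤ M) (hMT : M < X₀ / T)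
    (h : Icc (0 : ℝ) T → ℝ → ℝ) (l : ℝ → ℝ)
    (hh_meas : Measurable fun p : Icc (0 : ℝ) T × ℝ => h p.1 p.2) (hl_meas : Measurable l)
    (c₁ : ℝ) (hc₁ : 0 < c₁)
    (hgrowth : ∀ t x, |h t x| + |l x| ≤ c₁ * Real.exp (c₁ * |x|)) :
    let G₁ : PoolMFG.Game T (Icc lo hi) (PoolMFG.expWeight c₁) :=
      PoolMFG.inducedGame σ l (PoolMFG.reward₁ X₀ k₀ φ h (PoolMFG.expWeight c₁))
    let G₂ : PoolMFG.Game T (Icc lo hi) (PoolMFG.expWeight c₁) :=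
      PoolMFG.inducedGame σ l (PoolMFG.reward₂ X₀ k₀ φ M h (PoolMFG.expWeight c₁))
    (G₁.S1 ∧ G₁.S2 P ξ W ∧ G₁.S3 ∧ G₁.S4 ∧ G₁.S5) ∧
      (G₂.S1 ∧ G₂.S2 P ξ W ∧ G₂.S3 ∧ G₂.S4 ∧ G₂.S5) := by
  intro G₁ G₂
  -- The control `0` lies in `A`, which forces the sign of `M`.
  have hM0 : 0 ≤ M := (abs_nonneg 0).trans (hM 0 ⟨hlo, hhi⟩)
  have hX : 0 < X₀ - T * M := by
    rw [lt_div_iff₀ hT] at hMT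
    linarith
  have hξ : Integrable (fun ω => Real.exp (4 * c₁ * |ξ ω|)) P := by
    have h4 := hlam₀ (4 * c₁) (by positivity)
    rw [← hξ_law.map_eq] at h4
    exact h4.comp_aemeasurable hξ_law.aemeasurable
  exact ⟨⟨PoolMFG.inducedGame_S1 isCompact_Icc (convex_Icc lo hi),
      PoolMFG.inducedGame_S2 hT hW hc₁.le hσ hξ hM,
      PoolMFG.reward₁_conditions hX₀.le hk₀.le hM0 hM hX hT.le hφ_pos.le hφ_le hh_meas hl_meas
        hc₁ hgrowth⟩,
    ⟨PoolMFG.inducedGame_S1 isCompact_Icc (convex_Icc lo hi),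
      PoolMFG.inducedGame_S2 hT hW hc₁.le hσ hξ hM,
      PoolMFG.reward₂_conditions hX₀.le hk₀.le hM0 hM hX hT.le hφ_pos.le hφ_le hh_meas hl_meas
        hc₁ hgrowth⟩⟩
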